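/- Let $q\ge 5$ be a prime power and let $\mathrm{AG}(2,q)$ be the Desarguesian affine plane of order $q$, that is, the plane obtained from the projective plane $\mathrm{PG}(2,q)$ over the field with $q$ elements by deleting a line $r_\infty$ together with its points. A blocking set of $\mathrm{AG}(2,q)$ is a set of points of $\mathrm{AG}(2,q)$ that meets every line of $\mathrm{AG}(2,q)$; it is minimal if none of its proper subsets is a blocking set of $\mathrm{AG}(2,q)$. Then: (1) for every integer $k$ with $2q-1\le k\le 3q-6$ there exists a minimal blocking set of $\mathrm{AG}(2,q)$ of size $k$; (2) if moreover $q$ is odd, then for every integer $k$ with $2q-1\le k\le 3q-4$ there exists a minimal blocking set of $\mathrm{AG}(2,q)$ of size $k$. -/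

import Mathlib

open scoped LinearAlgebra.Projectivization

/-- The points of the projective plane `PG(2, q)` over the field `F` with `q` elements. -/
abbrev PGPoint (F : Type*) [Field F] : Type _ := ℙ F (Fin 3 → F)

/-- The lines of `PG(2, q)`, given by their homogeneous line coordinates. Incidence `P ∈ l` is
Mathlib's (`Configuration.ofField`): the point `[x₀ : x₁ : x₂]` lies on the line
`[a₀ : a₁ : a₂]` iff `a₀ x₀ + a₁ x₁ + a₂ x₂ = 0`. -/
abbrev PGLine (F : Type*) [Field F] : Type _ := ℙ F (Fin 3 → F)

/-- The points of the affine plane `AG(2, q) = PG(2, q) ∖ r`: the points of `PG(2, q)` that are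
not on the line `r`. -/
abbrev AGPoint {F : Type*} [Field F] (r : PGLine F) : Type _ := {P : PGPoint F // P ∉ r}

/-- The lines of the affine plane `AG(2, q) = PG(2, q) ∖ r`: the lines of `PG(2, q)` except
`r`. -/
abbrev AGLine {F : Type*} [Field F] (r : PGLine F) : Type _ := {l : PGLine F // l ≠ r}

/-- Incidence in `AG(2, q) = PG(2, q) ∖ r` is inherited from `PG(2, q)`. -/
instance {F : Type*} [Field F] (r : PGLine F) : Membership (AGPoint r) (AGLine r) :=
  ⟨fun l P => P.1 ∈ l.1⟩

/-- A blocking set of `AG(2, q) = PG(2, q) ∖ r`: a set of points meeting every line. -/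
def IsAffineBlockingSet {F : Type*} [Field F] (r : PGLine F) (B : Set (AGPoint r)) : Prop :=
  ∀ l : AGLine r, ∃ P ∈ B, P ∈ l

/-- A minimal blocking set of `AG(2, q) = PG(2, q) ∖ r`: a blocking set no proper subset of which
is a blocking set. -/
def IsMinimalAffineBlockingSet {F : Type*} [Field F] (r : PGLine F) (B : Set (AGPoint r)) :
    Prop :=
  IsAffineBlockingSet r B ∧ ∀ B' : Set (AGPoint r), B' ⊂ B → ¬ IsAffineBlockingSet r B'

open Matrix Projectivization

/-! Write points as `[x : y : z]` and delete the line `y + z = 0`. It passes through the vertex `[1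
: 0 : 0]` of the coordinate triangle and meets the side `x = 0` in `[0 : -1 : 1]`. The other affine
points of the three sides, without the vertices, form a minimal blocking set of size `3q - 4`.

For `t ≠ 0, -1`, trade `[0 : t : 1]` and `[t : 0 : 1]` for `[t : t : 1]`, the common point of the
lines `y = tz` and `x = tz` that they guarded. Each trade lowers the size by one, so `0` to `q - 3`
trades give every size from `3q - 4` down to `2q - 1`. Minimality holds because every point lies on
a tangent (`isTangentFrame_triangleSet`); only `[1 : 1 : 0]` restricts the choice of trades. -/

/-- A set of representatives, in a frame in which the deleted line is `[0 : 1 : 1]`, of a blocking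
set every point of which lies on a tangent line. -/
structure IsTangentFrame {F : Type*} [Field F] (S : Set (Fin 3 → F)) : Prop where
  affine : ∀ v ∈ S, v ⬝ᵥ ![0, 1, 1] ≠ 0
  reduced : ∀ v ∈ S, ∀ w ∈ S, ∀ c : F, c • w = v → v = w
  blocking : ∀ a : Fin 3 → F, (∀ c : F, c • ![0, 1, 1] ≠ a) → ∃ v ∈ S, v ⬝ᵥ a = 0
  tangent : ∀ v ∈ S, ∃ a : Fin 3 → F, (∀ c : F, c • ![0, 1, 1] ≠ a) ∧ v ⬝ᵥ a = 0 ∧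
    ∀ w ∈ S, w ⬝ᵥ a = 0 → w = v

theorem vec_zero_one_one_ne_zero {F : Type*} [Field F] : (![0, 1, 1] : Fin 3 → F) ≠ 0 :=
  fun h => one_ne_zero (congrFun h 1)

/-- `SL₃` is transitive on lines, so one deleted line suffices. A tangent at each point forbids
removing it. -/
theorem IsTangentFrame.exists_minimal_blockingSet {F : Type*} [Field F] {S : Set (Fin 3 → F)}
    (hS : IsTangentFrame S) (r : PGLine F) :
    ∃ B : Set (AGPoint r), IsMinimalAffineBlockingSet r B ∧ B.ncard = S.ncard := by
  obtain ⟨g, hg⟩ := MulAction.exists_smul_eq (Matrix.SpecialLinearGroup (Fin 3) F)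
    (Projectivization.mk F ![0, 1, 1] vec_zero_one_one_ne_zero) r
  let M : Matrix (Fin 3) (Fin 3) F := g
  let N : Matrix (Fin 3) (Fin 3) F := ↑(g⁻¹)
  have hNM : N * M = 1 := by
    rw [← Matrix.SpecialLinearGroup.coe_mul, inv_mul_cancel,
      Matrix.SpecialLinearGroup.coe_one]
  -- Points move by the inverse matrix acting on rows, lines by the matrix acting on columns; this
  -- preserves incidence.
  have hdot (v a : Fin 3 → F) : (v ᵥ* N) ⬝ᵥ (M *ᵥ a) = v ⬝ᵥ a := by
    rw [← dotProduct_mulVec, mulVec_mulVec, hNM, one_mulVec]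
  have hvec (v : Fin 3 → F) : (v ᵥ* N) ᵥ* M = v := by
    rw [vecMul_vecMul, hNM, vecMul_one]
  have hne (v : Fin 3 → F) (hv : v ≠ 0) : v ᵥ* N ≠ 0 := fun h => hv <| by
    rw [← hvec v, h, zero_vecMul]
  have hne' (a : Fin 3 → F) (ha : a ≠ 0) : M *ᵥ a ≠ 0 := fun h => ha <|
    dotProduct_eq_zero_iff.1 fun w => by rw [dotProduct_comm, ← hdot, h, dotProduct_zero]
  have hS0 (v : Fin 3 → F) (hv : v ∈ S) : v ≠ 0 := fun h => hS.affine v hv <| by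
    rw [h, zero_dotProduct]
  have hsmul (a : Fin 3 → F) (ha : a ≠ 0) : g • Projectivization.mk F a ha =
      .mk F (M *ᵥ a) (hne' a ha) := rfl
  let φ : S → AGPoint r := fun v => ⟨.mk F (v.1 ᵥ* N) (hne _ (hS0 _ v.2)), by
    rw [← hg, hsmul, Configuration.ofField.mem_iff, orthogonal_mk, hdot]
    exact hS.affine v.1 v.2⟩
  have hφ : Function.Injective φ := by
    intro v w h
    obtain ⟨c, hc⟩ := (mk_eq_mk_iff' _ _ _ _ _).1 (Subtype.ext_iff.1 h)
    refine Subtype.ext (hS.reduced _ v.2 _ w.2 c ?_)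
    rw [← hvec v.1, ← hc, smul_vecMul, hvec]
  have hline (a : Fin 3 → F) (ha : a ≠ 0) :
      g • Projectivization.mk F a ha ≠ r ↔ ∀ c : F, c • ![0, 1, 1] ≠ a := by
    rw [← hg, (MulAction.injective g).ne_iff, Ne, mk_eq_mk_iff']
    exact not_exists
  have hmem (v : S) (a : Fin 3 → F) (ha : a ≠ 0) (h : g • Projectivization.mk F a ha ≠ r) :
      φ v ∈ (⟨g • Projectivization.mk F a ha, h⟩ : AGLine r) ↔ v.1 ⬝ᵥ a = 0 := by
    rw [← hdot v.1 a]; rfl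
  refine ⟨Set.range φ, ⟨?_, ?_⟩, ?_⟩
  · rintro ⟨l, hl⟩
    obtain ⟨l, rfl⟩ := MulAction.surjective g l
    induction l using Projectivization.ind with | h a ha =>
    obtain ⟨v, hv, hva⟩ := hS.blocking a ((hline a ha).1 hl)
    exact ⟨φ ⟨v, hv⟩, ⟨_, rfl⟩, (hmem ⟨v, hv⟩ a ha hl).2 hva⟩
  · intro B' hB' hblock
    obtain ⟨hsub, _, ⟨v, rfl⟩, hv⟩ := Set.ssubset_iff_exists.1 hB'
    obtain ⟨a, har, hva, hat⟩ := hS.tangent v.1 v.2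
    have ha : a ≠ 0 := fun h => har 0 (by rw [h, zero_smul])
    obtain ⟨P, hP, hPl⟩ := hblock ⟨g • Projectivization.mk F a ha, (hline a ha).2 har⟩
    obtain ⟨w, rfl⟩ := hsub hP
    have := hat w.1 w.2 ((hmem w a ha _).1 hPl)
    rw [Subtype.ext this] at hP
    exact hv hP
  · rw [← Set.image_univ, Set.ncard_image_of_injective _ hφ, Set.ncard_univ, Nat.card_coe_set_eq]

section TriangleSet

variable {F : Type*} [Field F] [Fintype F] [DecidableEq F]

/-- The points `[p : 1 : 0]` with `p ≠ 0`, `[0 : e : 1]` with `e ∉ T ∪ {0, -1}`, `[m : 0 : 1]` with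
`m ∉ T ∪ {0}`, and `[t : t : 1]` with `t ∈ T`. -/
def triangleSet (T : Finset F) : Finset (Fin 3 → F) :=
  ({0}ᶜ : Finset F).image (fun p => ![p, 1, 0]) ∪
    (((insert 0 (insert (-1) T))ᶜ : Finset F).image (fun e => ![0, e, 1]) ∪
      (((insert 0 T)ᶜ : Finset F).image (fun m => ![m, 0, 1]) ∪
        T.image (fun t => ![t, t, 1])))

theorem mem_triangleSet {T : Finset F} {v : Fin 3 → F} :
    v ∈ triangleSet T ↔ (∃ p, p ≠ 0 ∧ v = ![p, 1, 0]) ∨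
      (∃ e, e ≠ 0 ∧ e ≠ -1 ∧ e ∉ T ∧ v = ![0, e, 1]) ∨
      (∃ m, m ≠ 0 ∧ m ∉ T ∧ v = ![m, 0, 1]) ∨ ∃ t ∈ T, v = ![t, t, 1] := by
  simp [triangleSet, eq_comm (b := v), and_assoc]

theorem card_triangleSet {T : Finset F} (h0 : 0 ∉ T) (h1 : -1 ∉ T)
    (hT : T.card + 3 ≤ Fintype.card F) :
    (triangleSet T).card = 3 * Fintype.card F - 4 - T.card := by
  have i1 : Function.Injective (fun p : F => ![p, 1, 0]) := fun a b h => congrFun h 0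
  have i2 : Function.Injective (fun p : F => ![0, p, 1]) := fun a b h => congrFun h 1
  have i3 : Function.Injective (fun p : F => ![p, 0, 1]) := fun a b h => congrFun h 0
  have i4 : Function.Injective (fun p : F => ![p, p, 1]) := fun a b h => congrFun h 0
  have h01 : (0 : F) ∉ insert (-1) T := by simp [h0]
  rw [triangleSet, Finset.card_union_of_disjoint, Finset.card_union_of_disjoint,
    Finset.card_union_of_disjoint, Finset.card_image_of_injective _ i1,
    Finset.card_image_of_injective _ i2, Finset.card_image_of_injective _ i3,
    Finset.card_image_of_injective _ i4, Finset.card_compl, Finset.card_compl, Finset.card_compl,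
    Finset.card_insert_of_notMem h01, Finset.card_insert_of_notMem h0,
    Finset.card_insert_of_notMem h1, Finset.card_singleton]
  · omega
  all_goals
    simp only [Finset.disjoint_left, Finset.mem_union, Finset.mem_image]
    rintro _ ⟨x, hx, rfl⟩
    simp at hx ⊢
    try grind

theorem isTangentFrame_triangleSet {T : Finset F} (h0 : 0 ∉ T) (h1 : -1 ∉ T)
    (hT : T.card + 3 ≤ Fintype.card F) (hneg : T.Nonempty → ∃ t ∈ T, -t ∈ insert (-1) T) :
    IsTangentFrame (triangleSet T : Set (Fin 3 → F)) where
  affine v hv := by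
    rw [Finset.mem_coe, mem_triangleSet] at hv
    obtain ⟨p, hp, rfl⟩ | ⟨e, he, he1, heT, rfl⟩ | ⟨m, hm, hmT, rfl⟩ | ⟨t, ht, rfl⟩ := hv <;>
      simp [dotProduct, Fin.sum_univ_three] <;> grind
  reduced v hv w hw c hc := by
    rw [Finset.mem_coe, mem_triangleSet] at hv hw
    have c0 := congrFun hc 0
    have c1 := congrFun hc 1
    have c2 := congrFun hc 2
    obtain ⟨p, hp, rfl⟩ | ⟨e, he, he1, heT, rfl⟩ | ⟨m, hm, hmT, rfl⟩ | ⟨t, ht, rfl⟩ := hv <;>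
    obtain ⟨p', hp', rfl⟩ | ⟨e', he', he1', heT', rfl⟩ | ⟨m', hm', hmT', rfl⟩ | ⟨t', ht', rfl⟩ := hw
      <;> simp at c0 c1 c2 <;> simp_all
  blocking a ha := by
    -- Keeps an untraded point on each of the sides `x = 0` and `y = 0`, so that these two lines are
    -- blocked; this is what bounds `T` by `q - 3`.
    have hex : ∃ e, e ≠ 0 ∧ e ≠ -1 ∧ e ∉ T := by
      obtain ⟨e, he⟩ := Finset.exists_mem_notMem_of_card_lt_card
        (s := insert 0 (insert (-1) T)) (t := Finset.univ) (by
          rw [Finset.card_univ]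
          have := Finset.card_insert_le (0 : F) (insert (-1) T)
          have := Finset.card_insert_le (-1 : F) T
          omega)
      exact ⟨e, by simpa using he⟩
    by_cases hα : a 0 = 0
    · by_cases hβ : a 1 = 0
      · exact ⟨![1, 1, 0], mem_triangleSet.2 (.inl ⟨1, one_ne_zero, rfl⟩),
          by simp [dotProduct, Fin.sum_univ_three, hα, hβ]⟩
      have he : -(a 2) / a 1 ≠ -1 := fun h => ha (a 1) <| by
        rw [div_eq_iff hβ] at h
        ext i; fin_cases i <;> simp [hα]; grind
      have hz (m : F) : ![m, -(a 2) / a 1, 1] ⬝ᵥ a = 0 := by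
        simp [dotProduct, Fin.sum_univ_three, hα]; field_simp; ring
      generalize -(a 2) / a 1 = e at he hz
      by_cases he0 : e = 0
      · subst he0
        obtain ⟨m, hm0, hm1, hmT⟩ := hex
        exact ⟨_, mem_triangleSet.2 (.inr (.inr (.inl ⟨m, hm0, hmT, rfl⟩))), hz m⟩
      by_cases heT : e ∈ T
      · exact ⟨_, mem_triangleSet.2 (.inr (.inr (.inr ⟨e, heT, rfl⟩))), hz e⟩
      · exact ⟨_, mem_triangleSet.2 (.inr (.inl ⟨e, he0, he, heT, rfl⟩)), hz 0⟩
    by_cases hβ : a 1 = 0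
    · have hz (e : F) : ![-(a 2) / a 0, e, 1] ⬝ᵥ a = 0 := by
        simp [dotProduct, Fin.sum_univ_three, hβ]; field_simp; ring
      generalize -(a 2) / a 0 = m at hz
      by_cases hm0 : m = 0
      · subst hm0
        obtain ⟨e, he0, he1, heT⟩ := hex
        exact ⟨_, mem_triangleSet.2 (.inr (.inl ⟨e, he0, he1, heT, rfl⟩)), hz e⟩
      by_cases hmT : m ∈ T
      · exact ⟨_, mem_triangleSet.2 (.inr (.inr (.inr ⟨m, hmT, rfl⟩))), hz m⟩
      · exact ⟨_, mem_triangleSet.2 (.inr (.inr (.inl ⟨m, hm0, hmT, rfl⟩))), hz 0⟩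
    -- A line through neither `[1 : 0 : 0]` nor `[0 : 1 : 0]` meets the untouched side `z = 0` off
    -- the vertices.
    · refine ⟨_, mem_triangleSet.2 (.inl ⟨-(a 1) / a 0, by simp [hα, hβ], rfl⟩), ?_⟩
      simp [dotProduct, Fin.sum_univ_three]; field_simp; ring
  tangent v hv := by
    rw [Finset.mem_coe, mem_triangleSet] at hv
    obtain ⟨p, hp, rfl⟩ | ⟨e, he, he1, heT, rfl⟩ | ⟨m, hm, hmT, rfl⟩ | ⟨t, ht, rfl⟩ := hv
    -- The tangent sought at `[p : 1 : 0]` is `x = p y + s z`. Taking `s = 0` works unless `p = 1`,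
    -- when that line contains every `[t : t : 1]`. Then `s = t` with `-t ∈ T ∪ {-1}` works: the
    -- line meets the other sides in `[t : 0 : 1]` and `[0 : -t : 1]`, both absent.
    · obtain ⟨s, hs⟩ : ∃ s, (∀ e, e ≠ 0 → e ≠ -1 → e ∉ T → -(p * e) ≠ s) ∧
          (∀ m, m ≠ 0 → m ∉ T → m ≠ s) ∧ ∀ t ∈ T, t - p * t ≠ s := by
        by_cases hp1 : p = 1 ∧ T.Nonempty
        · obtain ⟨rfl, hTn⟩ := hp1
          obtain ⟨t, ht, htn⟩ := hneg hTn
          rw [Finset.mem_insert] at htn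
          refine ⟨t, ?_, ?_, ?_⟩ <;> grind
        · refine ⟨0, ?_, ?_, ?_⟩
          · intro e he _ _; simp [hp, he]
          · intro m hm _; exact hm
          · intro t ht h
            refine hp1 ⟨?_, ⟨t, ht⟩⟩
            have : t ≠ 0 := fun h => h0 (h ▸ ht)
            grind
      obtain ⟨hs1, hs2, hs3⟩ := hs
      refine ⟨![1, -p, -s], fun c h => by simpa using congrFun h 0,
        by simp [dotProduct, Fin.sum_univ_three], fun w hw => ?_⟩
      rw [Finset.mem_coe, mem_triangleSet] at hw
      obtain ⟨p', hp', rfl⟩ | ⟨e', he', he1', heT', rfl⟩ | ⟨m', hm', hmT', rfl⟩ | ⟨t', ht', rfl⟩ := hw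
        <;> simp [dotProduct, Fin.sum_univ_three] <;> grind
    · refine ⟨![0, 1, -e], fun c h => ?_,
        by simp [dotProduct, Fin.sum_univ_three], fun w hw => ?_⟩
      · have c1 := congrFun h 1
        have c2 := congrFun h 2
        simp at c1 c2
        grind
      rw [Finset.mem_coe, mem_triangleSet] at hw
      obtain ⟨p', hp', rfl⟩ | ⟨e', he', he1', heT', rfl⟩ | ⟨m', hm', hmT', rfl⟩ | ⟨t', ht', rfl⟩ := hw
        <;> simp [dotProduct, Fin.sum_univ_three] <;> grind
    · refine ⟨![1, 0, -m], fun c h => by simpa using congrFun h 0,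
        by simp [dotProduct, Fin.sum_univ_three], fun w hw => ?_⟩
      rw [Finset.mem_coe, mem_triangleSet] at hw
      obtain ⟨p', hp', rfl⟩ | ⟨e', he', he1', heT', rfl⟩ | ⟨m', hm', hmT', rfl⟩ | ⟨t', ht', rfl⟩ := hw
        <;> simp [dotProduct, Fin.sum_univ_three] <;> grind
    · refine ⟨![1, 0, -t], fun c h => by simpa using congrFun h 0,
        by simp [dotProduct, Fin.sum_univ_three], fun w hw => ?_⟩
      rw [Finset.mem_coe, mem_triangleSet] at hw
      obtain ⟨p', hp', rfl⟩ | ⟨e', he', he1', heT', rfl⟩ | ⟨m', hm', hmT', rfl⟩ | ⟨t', ht', rfl⟩ := hw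
        <;> simp [dotProduct, Fin.sum_univ_three] <;> grind

/-- In characteristic 2 any `t ∈ T` serves, since `-t = t`; otherwise put `1` in `T`, as `-1` is the
deleted point of `x = 0`. -/
theorem exists_finset_card_eq_of_neg_mem (j : ℕ) (hj : j + 3 ≤ Fintype.card F) :
    ∃ T : Finset F, T.card = j ∧ 0 ∉ T ∧ -1 ∉ T ∧
      (T.Nonempty → ∃ t ∈ T, -t ∈ insert (-1) T) := by
  have hcard : j ≤ ({0, -1}ᶜ : Finset F).card := by
    rw [Finset.card_compl]
    have := Finset.card_le_two (a := (0 : F)) (b := -1)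
    omega
  by_cases h2 : (1 : F) = -1
  · obtain ⟨T, hT, rfl⟩ := Finset.exists_subset_card_eq hcard
    refine ⟨T, rfl, fun h => by simpa using hT h, fun h => by simpa using hT h, ?_⟩
    rintro ⟨t, ht⟩
    refine ⟨t, ht, Finset.mem_insert_of_mem ?_⟩
    rwa [← neg_one_mul, ← h2, one_mul]
  · rcases Nat.eq_zero_or_pos j with rfl | hj0
    · exact ⟨∅, by simp⟩
    have hsub : ({1} : Finset F) ⊆ {0, -1}ᶜ := by simp [h2]
    obtain ⟨T, h1T, hT, rfl⟩ := Finset.exists_subsuperset_card_eq hsub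
      (by simpa using Nat.succ_le_of_lt hj0) hcard
    exact ⟨T, rfl, fun h => by simpa using hT h, fun h => by simpa using hT h,
      fun _ => ⟨1, by simpa using h1T, Finset.mem_insert_self _ _⟩⟩

end TriangleSet

theorem exists_minimal_affineBlockingSet_ncard_eq {F : Type*} [Field F] [Fintype F] (r : PGLine F)
    (k : ℕ) (hk : 2 * Fintype.card F - 1 ≤ k) (hk' : k ≤ 3 * Fintype.card F - 4)
    (hF : 3 ≤ Fintype.card F) :
    ∃ B : Set (AGPoint r), IsMinimalAffineBlockingSet r B ∧ B.ncard = k := by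
  classical
  obtain ⟨T, hT, h0, h1, hneg⟩ := exists_finset_card_eq_of_neg_mem (F := F)
    (3 * Fintype.card F - 4 - k) (by omega)
  have hT3 : T.card + 3 ≤ Fintype.card F := by omega
  obtain ⟨B, hB, hBk⟩ :=
    (isTangentFrame_triangleSet h0 h1 hT3 hneg).exists_minimal_blockingSet r
  refine ⟨B, hB, ?_⟩
  rw [hBk, Set.ncard_coe_finset, card_triangleSet h0 h1 hT3]
  omega

theorem mainTheorem6 {F : Type*} [Field F] [Fintype F] (q : ℕ) (hq : Fintype.card F = q)
    (hq5 : 5 ≤ q) (r : PGLine F) :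
    (∀ k : ℕ, 2 * q - 1 ≤ k → k ≤ 3 * q - 6 →
      ∃ B : Set (AGPoint r), IsMinimalAffineBlockingSet r B ∧ B.ncard = k) ∧
    (Odd q → ∀ k : ℕ, 2 * q - 1 ≤ k → k ≤ 3 * q - 4 →
      ∃ B : Set (AGPoint r), IsMinimalAffineBlockingSet r B ∧ B.ncard = k) := by
  subst hq
  exact ⟨fun k hk hk' => exists_minimal_affineBlockingSet_ncard_eq r k hk (by omega) (by omega),
    fun _ k hk hk' => exists_minimal_affineBlockingSet_ncard_eq r k hk hk' (by omega)⟩
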